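/- Let $q$ be an odd prime power and $\mathcal{A}=\mathbb{F}_q[T]$, with $\deg 0=-\infty$; $(A,B)$ denotes the monic greatest common divisor of two polynomials not both zero. For $\alpha=(\alpha_0,\dots,\alpha_n)\in\mathbb{F}_q^{n+1}$ and $a+b\le n+2$, let $H_{a,b}(\alpha)$ be the $a\times b$ Hankel matrix $(\alpha_{i+j})_{0\le i<a,\,0\le j<b}$. Put $n_1=\lfloor (n+2)/2\rfloor$, $n_2=\lfloor (n+3)/2\rfloor$. Let $r(\alpha)=\operatorname{rank}H_{n_1,n_2}(\alpha)$; let $\rho(\alpha)$ be the largest $k\in\{1,\dots,n_1\}$ such that $H_{k,k}(\alpha)$ is invertible, or $0$ if there is none; let $\pi(\alpha)=r(\alpha)-\rho(\alpha)$. Let $\rho^{*}(\alpha)$ be the largest $k\in\{1,\dots,n_2-1\}$ such that $H_{k,k}(\alpha)$ is invertible, or $0$ if there is none, and $\pi^{*}(\alpha)=r(\alpha)-\rho^{*}(\alpha)$. Let $\mathcal{L}_n(r_1,\rho_1,\pi_1)$ (respectively $\mathcal{L}^{*}_n(r_1,\rho_1,\pi_1)$) be the set of $\alpha\in\mathbb{F}_q^{n+1}$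 with $(r,\rho,\pi)(\alpha)=(r_1,\rho_1,\pi_1)$ (respectively $(r,\rho^{*},\pi^{*})(\alpha)=(r_1,\rho_1,\pi_1)$). For $B=\sum_i b_iT^i$ with $\deg B\le k$ let $[B]_k=(b_0,\dots,b_k)$. For $s\le n$, $\alpha\in\mathbb{F}_q^{n+1}$ and $v=(v_0,\dots,v_s)$, let $\alpha\odot v\in\mathbb{F}_q^{n-s+1}$ have entries $(\alpha\odot v)_i=\sum_{j=0}^{s}\alpha_{i+j}v_j$, $0\le i\le n-s$. A polynomial $A_1$ is a first characteristic polynomial of $\alpha\in\mathbb{F}_q^{n+1}$ if it is monic of degree $\rho(\alpha)$ and there is $A_2\in\mathcal{A}$ with $\deg A_2\le n-r(\alpha)+2$, coprime to $A_1$, such that for all $l,m\ge 0$ with $l+m=n$, $$\ker H_{l+1,m+1}(\alpha)=\big\{[B_1A_1+B_2A_2]_m:\ B_1,B_2\in\mathcal{A},\ \deg B_1\le m-r(\alpha),\ \deg B_2\le m-(n-r(\alpha)+2)\big\}.$$ **Lemma.** (1) Let $0\le s\le n$ with $n\ge 2$, let $W\in\mathcal{A}$ be non-zero with $s_1:=\deg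 W\le s$, and let $\alpha\in\mathcal{L}_n(r_1,\rho_1,\pi_1)$ with $n\ge 2r_1+s-1$. Then $\alpha$ has exactly one first characteristic polynomial $A_1(\alpha)$, and $$r(\alpha\odot[W]_s)=r_1-\deg(A_1(\alpha),W)-\min\{s-s_1,\pi_1\},$$ $$\rho(\alpha\odot[W]_s)=\rho_1-\deg(A_1(\alpha),W),\qquad \pi(\alpha\odot[W]_s)=\max\{0,\pi_1-(s-s_1)\};$$ moreover $\alpha\odot[W]_s$ has exactly one first characteristic polynomial, namely $$A_1(\alpha\odot[W]_s)=\frac{A_1(\alpha)}{(A_1(\alpha),W)}.$$ (2) Let $s\ge 0$, let $W\in\mathcal{A}$ be non-zero with $\deg W=s$, and let $n-s\ge 2$ be even. If $\alpha\in\mathcal{L}^{*}_n\big(\tfrac{n-s}{2}+1,0,\tfrac{n-s}{2}+1\big)$, then $\alpha\odot[W]_s\in\mathcal{L}^{*}_{n-s}\big(\tfrac{n-s}{2}+1,0,\tfrac{n-s}{2}+1\big)$. -/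

import Mathlib

open Polynomial Matrix

noncomputable section

namespace HankelSeq

variable {F : Type*} [Field F]

/-- The bound `deg B ≤ d` for an integer `d`, possibly negative, where `deg 0 = -∞`. -/
def DegLE (B : F[X]) (d : ℤ) : Prop :=
  ∀ i : ℕ, d < (i : ℤ) → B.coeff i = 0

/-- The monic greatest common divisor of two polynomials that are not both zero. -/
def monicGcd (A B : F[X]) : F[X] :=
  letI : DecidableEq F[X] := Classical.decEq _
  EuclideanDomain.gcd A B * C (EuclideanDomain.gcd A B).leadingCoeff⁻¹

/-- The vector `[B]_k = (b_0, …, b_k)` of coefficients of a polynomial `B` of degree at most `k`. -/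
def coeffVec (B : F[X]) (k : ℕ) : Fin (k + 1) → F :=
  fun i => B.coeff i

/-- The `a × b` Hankel matrix `H_{a,b}(α)` of `α = (α_0, …, α_n)`, with entry `α_{i+j}` at `(i, j)`
(indices from `0`). It is only used for `a + b ≤ n + 2`, where every `i + j` is at most `n`; for
`a + b < n + 2` it is the Hankel matrix of a truncation of `α`. -/
def hankel {n : ℕ} (α : Fin (n + 1) → F) (a b : ℕ) : Matrix (Fin a) (Fin b) F :=
  Matrix.of fun i j => if h : (i : ℕ) + j < n + 1 then α ⟨(i : ℕ) + j, h⟩ else 0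

/-- `r(α)`: the rank of `H_{n₁,n₂}(α)` with `n₁ = ⌊(n+2)/2⌋` and `n₂ = ⌊(n+3)/2⌋`. -/
def rk {n : ℕ} (α : Fin (n + 1) → F) : ℕ :=
  (hankel α ((n + 2) / 2) ((n + 3) / 2)).rank

open Classical in
/-- `ρ(α)`: the largest `k` in `{1, …, n₁}` for which `H_{k,k}(α)` is invertible, and `0` if
there is none. -/
def rho {n : ℕ} (α : Fin (n + 1) → F) : ℕ :=
  Nat.findGreatest (fun k => IsUnit (hankel α k k)) ((n + 2) / 2)

open Classical in
/-- The strict version of `ρ(α)`: the largest `k` in `{1, …, n₂ - 1}` for which `H_{k,k}(α)` is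
invertible, and `0` if there is none. -/
def strictRho {n : ℕ} (α : Fin (n + 1) → F) : ℕ :=
  Nat.findGreatest (fun k => IsUnit (hankel α k k)) ((n + 3) / 2 - 1)

/-- `π(α) = r(α) - ρ(α)`. -/
def piChar {n : ℕ} (α : Fin (n + 1) → F) : ℤ :=
  (rk α : ℤ) - rho α

/-- The strict version of `π(α)`. -/
def strictPi {n : ℕ} (α : Fin (n + 1) → F) : ℤ :=
  (rk α : ℤ) - strictRho α

/-- The set `𝓛_n(r₁, ρ₁, π₁)` of sequences `(α_0, …, α_n)` with given `r`, `ρ` and `π`. -/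
def seqSet (F : Type*) [Field F] (n r₁ ρ₁ π₁ : ℕ) : Set (Fin (n + 1) → F) :=
  {α | rk α = r₁ ∧ rho α = ρ₁ ∧ piChar α = π₁}

/-- The set of sequences `(α_0, …, α_n)` with given `r`, strict `ρ` and strict `π`. -/
def strictSeqSet (F : Type*) [Field F] (n r₁ ρ₁ π₁ : ℕ) : Set (Fin (n + 1) → F) :=
  {α | rk α = r₁ ∧ strictRho α = ρ₁ ∧ strictPi α = π₁}

/-- `A₁` and `A₂` are first and second characteristic polynomials of `α`: they are coprime, `A₁` is
monic of degree `ρ(α)`, `deg A₂ ≤ n - r(α) + 2`, and for all `l + m = n` the kernel of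
`H_{l+1,m+1}(α)` consists of the vectors `[B₁ A₁ + B₂ A₂]_m` with `deg B₁ ≤ m - r(α)` and
`deg B₂ ≤ m - (n - r(α) + 2)`. -/
def IsCharPolyPair {n : ℕ} (α : Fin (n + 1) → F) (A₁ A₂ : F[X]) : Prop :=
  IsCoprime A₁ A₂ ∧ A₁.Monic ∧ A₁.natDegree = rho α ∧
    DegLE A₂ ((n : ℤ) - rk α + 2) ∧
    ∀ l m : ℕ, l + m = n →
      {v : Fin (m + 1) → F | hankel α (l + 1) (m + 1) *ᵥ v = 0} =
        {v | ∃ B₁ B₂ : F[X], DegLE B₁ ((m : ℤ) - rk α) ∧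
          DegLE B₂ ((m : ℤ) - ((n : ℤ) - rk α + 2)) ∧
          v = coeffVec (B₁ * A₁ + B₂ * A₂) m}

/-- `A₁` is a first characteristic polynomial of `α`. -/
def IsFirstCharPoly {n : ℕ} (α : Fin (n + 1) → F) (A₁ : F[X]) : Prop :=
  ∃ A₂ : F[X], IsCharPolyPair α A₁ A₂

/-- The sequence `α ⊙ v` of length `(n + 1) - (s + 1) + 1` with `i`-th entry
`∑_j α_{i+j} v_j`. -/
def odot {n s : ℕ} (hs : s ≤ n) (α : Fin (n + 1) → F) (v : Fin (s + 1) → F) :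
    Fin (n - s + 1) → F :=
  fun i => ∑ j : Fin (s + 1), α ⟨(i : ℕ) + j, by omega⟩ * v j

end HankelSeq

end

/-! Let φ be a linear functional on `F[X]` with first moments α_0, …, α_n. The kernel of H_{a,b}(α)
becomes the space `orthLT φ a b`, and passing to α ⊙ [W]_s replaces φ by φ(W ·): a polynomial B of
degree below b lies in the new kernel iff WB lies in the old kernel with s more columns.

Suppose 2r ≤ n + 1 and put d = r, c = n + 1 - r. A single monic P then governs the kernels
(`IsGen`): if a + b = n + 2 and a ≥ d, the kernel is {PC : deg C < b - d}. This follows by a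
dimension count through transposition. Moreover deg P = ρ, and P is the only first characteristic
polynomial; the second polynomial, needed when a < d, comes from `IsGen.exists_pair`.

Part (1) rests on `IsGen.comp_mulLeft`. Write P = GP' and W = GW' with P', W' coprime. Then WB = PC
forces B = P'D and C = W'D, so P' is the new generator, and the degree bounds on B and C give the
new rank max(deg P', d - s + deg W').

In part (2) with s ≥ 1, the condition ρ* = 0 forces P = 1, and the kernels can be read off. For s =
0 the sequence is merely scaled. -/

namespace HankelSeq

variable {F : Type*} [Field F]

/-! ### Polynomials of bounded degree -/

theorem mem_degreeLT_iff_coeff {B : F[X]} {k : ℕ} :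
    B ∈ degreeLT F k ↔ ∀ i, k ≤ i → B.coeff i = 0 := by
  rw [mem_degreeLT, degree_lt_iff_coeff_zero]

theorem mem_degreeLT_iff_natDegree {B : F[X]} (hB : B ≠ 0) {k : ℕ} :
    B ∈ degreeLT F k ↔ B.natDegree < k := by
  rw [mem_degreeLT, natDegree_lt_iff_degree_lt hB]

theorem degLE_iff {B : F[X]} {z : ℤ} {k : ℕ} (h : (z + 1).toNat = k) :
    DegLE B z ↔ B ∈ degreeLT F k := by
  rw [mem_degreeLT_iff_coeff]
  exact forall_congr' fun i => by rw [show z < (i : ℤ) ↔ k ≤ i by omega]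

theorem mul_mem_degreeLT_of_natDegree {A B : F[X]} {a b k : ℕ} (hA : A.natDegree ≤ a)
    (hB : B ∈ degreeLT F b) (h : a + b ≤ k) : A * B ∈ degreeLT F k := by
  rcases eq_or_ne B 0 with rfl | hB0
  · simp
  rcases eq_or_ne A 0 with rfl | hA0
  · simp
  rw [mem_degreeLT_iff_natDegree hB0] at hB
  rw [mem_degreeLT_iff_natDegree (mul_ne_zero hA0 hB0), natDegree_mul hA0 hB0]
  omega

theorem mem_degreeLT_of_mul {A B : F[X]} {k : ℕ} (hA : A ≠ 0) (h : A * B ∈ degreeLT F k) :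
    B ∈ degreeLT F (k - A.natDegree) := by
  rcases eq_or_ne B 0 with rfl | hB0
  · simp
  rw [mem_degreeLT_iff_natDegree (mul_ne_zero hA hB0), natDegree_mul hA hB0] at h
  rw [mem_degreeLT_iff_natDegree hB0]
  omega

theorem natDegree_le_of_mem_degreeLT {B : F[X]} {k : ℕ} (h : B ∈ degreeLT F (k + 1)) :
    B.natDegree ≤ k := by
  rcases eq_or_ne B 0 with rfl | hB0
  · simp
  rw [mem_degreeLT_iff_natDegree hB0] at h
  omega

theorem finrank_degreeLT (k : ℕ) : Module.finrank F (degreeLT F k) = k := by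
  rw [(degreeLTEquiv F k).finrank_eq, Module.finrank_fin_fun]

instance (k : ℕ) : Module.Finite F (degreeLT F k) :=
  Module.Finite.equiv (degreeLTEquiv F k).symm

/-! ### Hankel kernels as orthogonal spaces -/

/-- Polynomials of degree less than `b` that are orthogonal, for the bilinear form
`(D, B) ↦ φ (D * B)`, to all polynomials of degree less than `a`. -/
noncomputable def orthLT (φ : F[X] →ₗ[F] F) (a b : ℕ) : Submodule F F[X] where
  carrier := {B | B ∈ degreeLT F b ∧ ∀ D ∈ degreeLT F a, φ (D * B) = 0}
  zero_mem' := by simp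
  add_mem' := fun hA hB => ⟨add_mem hA.1 hB.1, fun D hD => by
    rw [mul_add, map_add, hA.2 D hD, hB.2 D hD, add_zero]⟩
  smul_mem' := fun c B hB => ⟨Submodule.smul_mem _ c hB.1, fun D hD => by
    rw [mul_smul_comm, map_smul, hB.2 D hD, smul_zero]⟩

theorem mem_orthLT {φ : F[X] →ₗ[F] F} {a b : ℕ} {B : F[X]} :
    B ∈ orthLT φ a b ↔ B ∈ degreeLT F b ∧ ∀ D ∈ degreeLT F a, φ (D * B) = 0 := Iff.rfl

theorem orthLT_mono {φ : F[X] →ₗ[F] F} {a a' b b' : ℕ} (ha : a' ≤ a) (hb : b ≤ b') :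
    orthLT φ a b ≤ orthLT φ a' b' := fun _ hB =>
  ⟨degreeLT_mono hb hB.1, fun D hD => hB.2 D (degreeLT_mono ha hD)⟩

instance (φ : F[X] →ₗ[F] F) (a b : ℕ) : Module.Finite F (orthLT φ a b) :=
  Submodule.finiteDimensional_of_le (S₂ := degreeLT F b) fun _ hB => hB.1

/-- The Hankel matrix with entries `φ (X ^ (i + j))`. -/
noncomputable def momentHankel (φ : F[X] →ₗ[F] F) (a b : ℕ) : Matrix (Fin a) (Fin b) F :=
  Matrix.of fun i j => φ (X ^ ((i : ℕ) + j))

theorem momentHankel_transpose (φ : F[X] →ₗ[F] F) (a b : ℕ) :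
    (momentHankel φ a b)ᵀ = momentHankel φ b a := by
  ext i j
  simp [momentHankel, add_comm]

theorem eq_sum_fin_of_mem_degreeLT {B : F[X]} {b : ℕ} (hB : B ∈ degreeLT F b) :
    B = ∑ j : Fin b, B.coeff j • X ^ (j : ℕ) := by
  ext i
  simp only [finsetSum_coeff, coeff_smul, coeff_X_pow, smul_eq_mul, mul_ite, mul_one, mul_zero]
  by_cases hi : i < b
  · rw [Finset.sum_eq_single ⟨i, hi⟩]
    · simp
    · intro j _ hj
      rw [if_neg]
      rintro rfl
      exact hj rfl
    · simp
  · rw [mem_degreeLT_iff_coeff.1 hB i (by omega), Finset.sum_eq_zero]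
    intro j _
    rw [if_neg (by omega)]

theorem momentHankel_mulVec (φ : F[X] →ₗ[F] F) {a b : ℕ} {B : F[X]} (hB : B ∈ degreeLT F b) :
    momentHankel φ a b *ᵥ (fun j : Fin b => B.coeff j) = fun i : Fin a => φ (X ^ (i : ℕ) * B) := by
  ext i
  conv_rhs => rw [eq_sum_fin_of_mem_degreeLT hB]
  simp [Matrix.mulVec, dotProduct, momentHankel, Finset.mul_sum, pow_add, mul_comm]

theorem mem_orthLT_iff_mulVec {φ : F[X] →ₗ[F] F} {a b : ℕ} {B : F[X]} (hB : B ∈ degreeLT F b) :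
    B ∈ orthLT φ a b ↔ momentHankel φ a b *ᵥ (fun j : Fin b => B.coeff j) = 0 := by
  rw [momentHankel_mulVec φ hB]
  constructor
  · intro h
    ext i
    exact h.2 _ ((mem_degreeLT_iff_natDegree (pow_ne_zero _ X_ne_zero)).2 (by simp))
  · intro h
    refine ⟨hB, fun D hD => ?_⟩
    rw [eq_sum_fin_of_mem_degreeLT hD, Finset.sum_mul, map_sum]
    refine Finset.sum_eq_zero fun i _ => ?_
    rw [smul_mul_assoc, map_smul, show φ (X ^ (i : ℕ) * B) = 0 from congrFun h i, smul_zero]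

theorem orthLT_eq_map (φ : F[X] →ₗ[F] F) (a b : ℕ) :
    orthLT φ a b = (((LinearMap.ker (momentHankel φ a b).mulVecLin).map
      (degreeLTEquiv F b).symm.toLinearMap).map (degreeLT F b).subtype) := by
  ext B
  simp only [Submodule.mem_map, LinearMap.mem_ker, Matrix.mulVecLin_apply]
  constructor
  · intro h
    exact ⟨⟨B, h.1⟩, ⟨degreeLTEquiv F b ⟨B, h.1⟩, (mem_orthLT_iff_mulVec h.1).1 h, by simp⟩, rfl⟩
  · rintro ⟨_, ⟨v, hv, rfl⟩, rfl⟩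
    refine (mem_orthLT_iff_mulVec (Subtype.property _)).2 ?_
    have : degreeLTEquiv F b ((degreeLTEquiv F b).symm v) = v := by simp
    rw [← this] at hv
    exact hv

theorem finrank_orthLT_add_rank (φ : F[X] →ₗ[F] F) (a b : ℕ) :
    Module.finrank F (orthLT φ a b) + (momentHankel φ a b).rank = b := by
  rw [orthLT_eq_map, Submodule.finrank_map_subtype_eq, LinearEquiv.finrank_map_eq, add_comm,
    Matrix.rank, LinearMap.finrank_range_add_finrank_ker, Module.finrank_fin_fun]

/-- Transposed Hankel matrices have equal rank. This is the source of all the dimension counts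
below. -/
theorem finrank_orthLT_symm (φ : F[X] →ₗ[F] F) (a b : ℕ) :
    Module.finrank F (orthLT φ a b) + a = Module.finrank F (orthLT φ b a) + b := by
  have h1 := finrank_orthLT_add_rank φ a b
  have h2 := finrank_orthLT_add_rank φ b a
  rw [← momentHankel_transpose, Matrix.rank_transpose] at h2
  omega

theorem orthLT_comp_mulLeft {φ : F[X] →ₗ[F] F} {W B : F[X]} {a b s : ℕ} (hW : W.natDegree ≤ s)
    (hB : B ∈ degreeLT F b) :
    B ∈ orthLT (φ ∘ₗ LinearMap.mulLeft F W) a b ↔ W * B ∈ orthLT φ a (b + s) := by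
  rw [mem_orthLT, mem_orthLT, and_iff_right hB,
    and_iff_right (mul_mem_degreeLT_of_natDegree hW hB (by omega))]
  simp only [LinearMap.comp_apply, LinearMap.mulLeft_apply, mul_left_comm]

/-! ### The generator of the kernels -/

/-- `P` is the monic generator of the kernels of the Hankel matrices of `φ` of format `a × b` with
`a + b = c + d + 1`, and `d ≤ c` is the smallest index at which the kernel is non-zero. -/
structure IsGen (φ : F[X] →ₗ[F] F) (c d : ℕ) (P : F[X]) : Prop where
  monic : P.Monic
  mem : P ∈ orthLT φ c (d + 1)
  eq_bot : orthLT φ (c + 1) d = ⊥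
  le : d ≤ c

namespace IsGen

variable {φ : F[X] →ₗ[F] F} {c d : ℕ} {P : F[X]}

theorem natDegree_le (h : IsGen φ c d P) : P.natDegree ≤ d :=
  natDegree_le_of_mem_degreeLT h.mem.1

theorem mul_mem (h : IsGen φ c d P) {a b : ℕ} (hab : a + b = c + d + 1) {B : F[X]}
    (hB : B ∈ degreeLT F (b - d)) : P * B ∈ orthLT φ a b := by
  rcases eq_or_ne B 0 with rfl | hB0
  · simp
  have hB' := (mem_degreeLT_iff_natDegree hB0).1 hB
  refine ⟨mul_mem_degreeLT_of_natDegree h.natDegree_le hB (by omega), fun D hD => ?_⟩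
  rw [mul_left_comm, mul_comm P]
  refine h.mem.2 _ ?_
  rw [mul_comm]
  exact mul_mem_degreeLT_of_natDegree (a := b - d - 1) (by omega) hD (by omega)

theorem finrank_map_mulLeft (h : IsGen φ c d P) (k : ℕ) :
    Module.finrank F ((degreeLT F k).map (LinearMap.mulLeft F P)) = k := by
  rw [← (Submodule.equivMapOfInjective (LinearMap.mulLeft F P)
    (fun _ _ hxy => mul_left_cancel₀ h.monic.ne_zero hxy) (degreeLT F k)).finrank_eq,
    finrank_degreeLT]

theorem map_le (h : IsGen φ c d P) {a b : ℕ} (hab : a + b = c + d + 1) :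
    (degreeLT F (b - d)).map (LinearMap.mulLeft F P) ≤ orthLT φ a b := by
  rintro _ ⟨B, hB, rfl⟩
  exact h.mul_mem hab hB

/-- The transposed matrix has trivial kernel, so both sides have dimension c + 1 - d. -/
theorem map_eq (h : IsGen φ c d P) :
    (degreeLT F (c + 1 - d)).map (LinearMap.mulLeft F P) = orthLT φ d (c + 1) := by
  refine Submodule.eq_of_le_of_finrank_eq (h.map_le (by omega)) ?_
  have h1 := finrank_orthLT_symm φ d (c + 1)
  have h2 := h.le
  rw [h.eq_bot, finrank_bot] at h1
  rw [h.finrank_map_mulLeft]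
  omega

theorem mem_iff (h : IsGen φ c d P) {a b : ℕ} (hab : a + b = c + d + 1) (hd : d ≤ a) {B : F[X]} :
    B ∈ orthLT φ a b ↔ ∃ C ∈ degreeLT F (b - d), B = P * C := by
  constructor
  · intro hB
    have h1 := orthLT_mono (φ := φ) hd (show b ≤ c + 1 by omega) hB
    rw [← h.map_eq] at h1
    obtain ⟨C, -, rfl⟩ := h1
    -- When deg P < d, the bound on deg PC is too weak to give deg C < b - d. Shifting by the
    -- largest admissible power of X recovers the sharp bound.
    have h2 : X ^ (c + 1 - b) * (P * C) ∈ orthLT φ d (c + 1) := by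
      refine ⟨mul_mem_degreeLT_of_natDegree (natDegree_X_pow_le _) hB.1 (by omega),
        fun D hD => ?_⟩
      rw [← mul_assoc, mul_comm D]
      exact hB.2 _ (mul_mem_degreeLT_of_natDegree (natDegree_X_pow_le _) hD (by omega))
    rw [← h.map_eq] at h2
    obtain ⟨C', hC', h3⟩ := h2
    rw [LinearMap.mulLeft_apply, mul_left_comm] at h3
    rw [mul_left_cancel₀ h.monic.ne_zero h3] at hC'
    have h4 := mem_degreeLT_of_mul (pow_ne_zero _ X_ne_zero) hC'
    rw [natDegree_X_pow] at h4
    exact ⟨C, degreeLT_mono (by omega) h4, rfl⟩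
  · rintro ⟨C, hC, rfl⟩
    exact h.mul_mem hab hC

theorem finrank_eq (h : IsGen φ c d P) {a b : ℕ} (hab : a + b = c + d + 1) (hd : d ≤ a) :
    Module.finrank F (orthLT φ a b) = b - d := by
  have heq : orthLT φ a b = (degreeLT F (b - d)).map (LinearMap.mulLeft F P) := by
    ext B
    rw [h.mem_iff hab hd, Submodule.mem_map]
    exact exists_congr fun C => and_congr_right fun _ => eq_comm
  rw [heq, h.finrank_map_mulLeft]

/-- With d - 1 rows and c + 2 columns the kernel has dimension at least c + 3 - d, one more than the
multiples of P supply. -/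
theorem exists_second (h : IsGen φ c d P) (hd : 1 ≤ d) :
    ∃ Q ∈ orthLT φ (d - 1) (c + 2), ∀ C ∈ degreeLT F (c + 2 - d), Q ≠ P * C := by
  by_contra! hcon
  have hle : orthLT φ (d - 1) (c + 2) ≤
      (degreeLT F (c + 2 - d)).map (LinearMap.mulLeft F P) := fun Q hQ => by
    obtain ⟨C, hC, rfl⟩ := hcon Q hQ
    exact ⟨C, hC, rfl⟩
  have h1 := Submodule.finrank_mono hle
  have h2 := finrank_orthLT_symm φ (d - 1) (c + 2)
  have h3 := h.le
  rw [h.finrank_map_mulLeft] at h1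
  omega

theorem comp_mulLeft_of_mul {W P' : F[X]} (h : IsGen φ c d (W * P')) {s : ℕ} (hW : W.Monic)
    (hWs : W.natDegree ≤ s) (hs : s ≤ d) (hP' : P' ∈ degreeLT F (d - s + 1)) :
    IsGen (φ ∘ₗ LinearMap.mulLeft F W) c (d - s) P' where
  monic := hW.of_mul_monic_left h.monic
  mem := by
    rw [orthLT_comp_mulLeft hWs hP', show d - s + 1 + s = d + 1 by omega]
    exact h.mem
  eq_bot := by
    rw [eq_bot_iff]
    intro B hB
    rw [orthLT_comp_mulLeft hWs hB.1, show d - s + s = d by omega, h.eq_bot,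
      Submodule.mem_bot] at hB
    rw [Submodule.mem_bot]
    exact (mul_eq_zero.1 hB).resolve_left hW.ne_zero
  le := by have := h.le; omega

/-- Dividing a common factor W out of P and Q lowers the generator index to d - s ≤ d - 1. The
kernel containing Q' is then already generated by P'. As s may exceed deg W, this also covers a
common zero at infinity. -/
theorem not_common_factor {W P' Q' : F[X]} (h : IsGen φ c d (W * P')) {s : ℕ} (hW : W.Monic)
    (hWs : W.natDegree ≤ s) (hs : 1 ≤ s) (hsd : s ≤ d) (hP' : P' ∈ degreeLT F (d - s + 1))
    (hQ' : Q' ∈ degreeLT F (c + 2 - s)) (hQ : W * Q' ∈ orthLT φ (d - 1) (c + 2)) :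
    ∃ C ∈ degreeLT F (c + 2 - d), W * Q' = W * P' * C := by
  have hle := h.le
  have h1 := h.comp_mulLeft_of_mul hW hWs hsd hP'
  have h2 : Q' ∈ orthLT (φ ∘ₗ LinearMap.mulLeft F W) (d - 1) (c + 2 - s) := by
    rwa [orthLT_comp_mulLeft hWs hQ', show c + 2 - s + s = c + 2 by omega]
  obtain ⟨C, hC, rfl⟩ := (h1.mem_iff (by omega) (by omega)).1 h2
  exact ⟨C, degreeLT_mono (by omega) hC, by rw [mul_assoc]⟩

end IsGen

/-! ### The monic gcd -/

section monicGcd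

variable {A B : F[X]}

theorem monicGcd_monic (hB : B ≠ 0) : (monicGcd A B).Monic := by
  let : DecidableEq F[X] := Classical.decEq _
  refine monic_mul_leadingCoeff_inv fun h => hB ?_
  exact (EuclideanDomain.gcd_eq_zero_iff.1 h).2

theorem isUnit_C_leadingCoeff_inv {G : F[X]} (hG : G ≠ 0) : IsUnit (C G.leadingCoeff⁻¹) :=
  isUnit_C.2 (by simpa using hG)

theorem exists_coprime_mul_monicGcd (hB : B ≠ 0) : ∃ A' B' : F[X], IsCoprime A' B' ∧
    A = monicGcd A B * A' ∧ B = monicGcd A B * B' := by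
  let : DecidableEq F[X] := Classical.decEq _
  set G := monicGcd A B with hG
  have hGm : G.Monic := monicGcd_monic hB
  have h0 : EuclideanDomain.gcd A B ≠ 0 := fun h => hB (EuclideanDomain.gcd_eq_zero_iff.1 h).2
  have hassoc : Associated (EuclideanDomain.gcd A B) G := by
    have hu := isUnit_C_leadingCoeff_inv h0
    have : G = EuclideanDomain.gcd A B * C (EuclideanDomain.gcd A B).leadingCoeff⁻¹ := by
      rfl
    rw [this]
    exact (associated_mul_unit_right _ _ hu)
  obtain ⟨A', hA'⟩ := hassoc.dvd'.trans (EuclideanDomain.gcd_dvd_left A B)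
  obtain ⟨B', hB'⟩ := hassoc.dvd'.trans (EuclideanDomain.gcd_dvd_right A B)
  refine ⟨A', B', ?_, hA', hB'⟩
  obtain ⟨u, hu⟩ := hassoc
  have h1 := EuclideanDomain.gcd_eq_gcd_ab A B
  refine ⟨EuclideanDomain.gcdA A B * u, EuclideanDomain.gcdB A B * u,
    mul_left_cancel₀ hGm.ne_zero ?_⟩
  generalize EuclideanDomain.gcdA A B = x at *
  generalize EuclideanDomain.gcdB A B = y at *
  rw [h1] at hu
  linear_combination hu - x * u * hA' - y * u * hB'

end monicGcd

/-! ### Invertibility in size deg P, and the second generator -/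

theorem IsGen.eq_zero_of_mem_orthLT {φ : F[X] →ₗ[F] F} {c d : ℕ} {P B : F[X]} (h : IsGen φ c d P)
    (hB : B ∈ orthLT φ P.natDegree P.natDegree) : B = 0 := by
  have hmod := h.natDegree_le
  have hle := h.le
  have h1 : B ∈ orthLT φ (c + 1) d := by
    refine ⟨degreeLT_mono hmod hB.1, fun D hD => ?_⟩
    -- Reduce D modulo P: the remainder is orthogonal to B by hypothesis, and the multiple of P
    -- contributes nothing by the orthogonality of P.
    rw [← EuclideanDomain.div_add_mod D P, add_mul, map_add]
    have h2 : D % P ∈ degreeLT F P.natDegree := by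
      rw [mem_degreeLT, ← degree_eq_natDegree h.monic.ne_zero]
      exact EuclideanDomain.mod_lt D h.monic.ne_zero
    rw [hB.2 _ h2, add_zero, mul_assoc, mul_comm P]
    refine h.mem.2 _ ?_
    rcases eq_or_ne B 0 with rfl | hB0
    · simp
    have h3 := (mem_degreeLT_iff_natDegree hB0).1 hB.1
    have h4 : P * (D / P) ∈ degreeLT F (c + 1) := by
      have h5 : P * (D / P) = D - D % P := by
        rw [eq_sub_iff_add_eq, EuclideanDomain.div_add_mod]
      rw [h5]
      exact sub_mem hD (degreeLT_mono (by omega) h2)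
    have h6 := mem_degreeLT_of_mul h.monic.ne_zero h4
    rw [mul_comm]
    exact mul_mem_degreeLT_of_natDegree (a := P.natDegree - 1) (by omega) h6 (by omega)
  rwa [h.eq_bot] at h1

theorem IsGen.isCoprime {φ : F[X] →ₗ[F] F} {c d : ℕ} {P Q : F[X]} (h : IsGen φ c d P)
    (hd : 1 ≤ d) (hQ : Q ∈ orthLT φ (d - 1) (c + 2))
    (hPQ : ∀ C ∈ degreeLT F (c + 2 - d), Q ≠ P * C) :
    IsCoprime P Q ∧ (P.natDegree < d → Q.natDegree = c + 1) := by
  have hQ0 : Q ≠ 0 := fun h0 => hPQ 0 (zero_mem _) (by rw [h0, mul_zero])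
  have hle := h.le
  have key : ∀ (W P' Q' : F[X]) (s : ℕ), W.Monic → W.natDegree ≤ s → 1 ≤ s → s ≤ d → P = W * P' →
      Q = W * Q' → P' ∈ degreeLT F (d - s + 1) → Q' ∈ degreeLT F (c + 2 - s) → False := by
    rintro W P' Q' s hW hWs hs hsd rfl rfl hP' hQ'
    obtain ⟨C, hC, heq⟩ := h.not_common_factor hW hWs hs hsd hP' hQ' hQ
    exact hPQ C hC heq
  constructor
  · obtain ⟨P', Q', hcop, hP, hQ'⟩ := exists_coprime_mul_monicGcd (A := P) hQ0
    have hG : (monicGcd P Q).Monic := monicGcd_monic hQ0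
    rcases Nat.eq_zero_or_pos (monicGcd P Q).natDegree with h0 | hpos
    · rw [eq_one_of_monic_natDegree_zero hG h0, one_mul] at hP hQ'
      rwa [hP, hQ']
    · have hP1 := hP ▸ h.mem.1
      have hQ1 := hQ' ▸ hQ.1
      have hdeg : (monicGcd P Q).natDegree ≤ P.natDegree :=
        natDegree_le_of_dvd ⟨P', hP⟩ h.monic.ne_zero
      have := h.natDegree_le
      exact (key _ P' Q' _ hG le_rfl hpos (by omega) hP hQ'
        (degreeLT_mono (by omega) (mem_degreeLT_of_mul hG.ne_zero hP1))
        (mem_degreeLT_of_mul hG.ne_zero hQ1)).elim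
  · intro hlt
    by_contra hne
    have h1 := natDegree_le_of_mem_degreeLT hQ.1
    -- W = 1 with weight s = 1 is the factor at infinity: both degrees fall short of their bounds d
    -- and c + 1.
    refine key 1 P Q 1 monic_one (by simp) le_rfl hd (by simp) (by simp) ?_ ?_
    · rw [mem_degreeLT_iff_natDegree h.monic.ne_zero]
      omega
    · rw [mem_degreeLT_iff_natDegree hQ0]
      omega

theorem IsGen.eq_zero_of_add_eq_zero {φ : F[X] →ₗ[F] F} {c d : ℕ} {P Q : F[X]}
    (h : IsGen φ c d P) (hcop : IsCoprime P Q) (hQ0 : Q ≠ 0)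
    (hQ : P.natDegree < d → Q.natDegree = c + 1)
    {B₁ B₂ : F[X]} (hB₁ : B₁ ∈ degreeLT F c) (hB₂ : B₂ ∈ degreeLT F (d - 1))
    (heq : P * B₁ + Q * B₂ = 0) : B₁ = 0 ∧ B₂ = 0 := by
  have hP0 := h.monic.ne_zero
  suffices hs : B₁ = 0 ∨ B₂ = 0 by
    rcases hs with rfl | rfl
    · simpa [hQ0] using heq
    · simpa [hP0] using heq
  by_contra! hne
  have h1 : P ∣ B₂ := hcop.dvd_of_dvd_mul_left ⟨-B₁, by linear_combination heq⟩
  have h2 : Q ∣ B₁ := hcop.symm.dvd_of_dvd_mul_left ⟨-B₂, by linear_combination heq⟩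
  have h3 := natDegree_le_of_dvd h1 hne.2
  have h4 := natDegree_le_of_dvd h2 hne.1
  have h5 := (mem_degreeLT_iff_natDegree hne.1).1 hB₁
  have h6 := (mem_degreeLT_iff_natDegree hne.2).1 hB₂
  have h7 := h.natDegree_le
  omega

/-- All kernels are generated by `P` and a second polynomial `Q` coprime to it. -/
theorem IsGen.exists_pair {φ : F[X] →ₗ[F] F} {c d : ℕ} {P : F[X]} (h : IsGen φ c d P) :
    ∃ Q ∈ degreeLT F (c + 2), IsCoprime P Q ∧ ∀ a b, 1 ≤ a → a + b = c + d + 1 → ∀ B,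
      B ∈ orthLT φ a b ↔ ∃ B₁ ∈ degreeLT F (b - d), ∃ B₂ ∈ degreeLT F (b - (c + 1)),
        B = B₁ * P + B₂ * Q := by
  have hle := h.le
  have large : ∀ Q a b, a + b = c + d + 1 → d ≤ a → ∀ B,
      B ∈ orthLT φ a b ↔ ∃ B₁ ∈ degreeLT F (b - d), ∃ B₂ ∈ degreeLT F (b - (c + 1)),
        B = B₁ * P + B₂ * Q := by
    intro Q a b hab hda B
    rw [h.mem_iff hab hda]
    refine exists_congr fun B₁ => and_congr_right fun _ => ?_
    rw [show b - (c + 1) = 0 by omega]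
    constructor
    · intro hB
      exact ⟨0, zero_mem _, by rw [hB]; ring⟩
    · rintro ⟨B₂, hB₂, rfl⟩
      have : B₂ = 0 := by
        ext i
        exact mem_degreeLT_iff_coeff.1 hB₂ i (Nat.zero_le i)
      rw [this]
      ring
  rcases Nat.eq_zero_or_pos d with hd0 | hd
  -- For d = 0 the second family is always zero, so any polynomial coprime to P serves.
  · refine ⟨1, ?_, isCoprime_one_right, fun a b _ hab => large 1 a b hab (by omega)⟩
    rw [mem_degreeLT_iff_natDegree one_ne_zero]
    simp
  obtain ⟨Q, hQ, hPQ⟩ := h.exists_second hd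
  obtain ⟨hcop, hdeg⟩ := h.isCoprime hd hQ hPQ
  have hQ0 : Q ≠ 0 := fun h0 => hPQ 0 (zero_mem _) (by rw [h0, mul_zero])
  refine ⟨Q, hQ.1, hcop, fun a b ha hab => ?_⟩
  by_cases hda : d ≤ a
  · exact large Q a b hab hda
  let M₁ : Submodule F F[X] := (degreeLT F (b - d)).map (LinearMap.mulLeft F P)
  let M₂ : Submodule F F[X] := (degreeLT F (b - (c + 1))).map (LinearMap.mulLeft F Q)
  have hM₁ : Module.finrank F M₁ = b - d := h.finrank_map_mulLeft _
  have hM₂ : Module.finrank F M₂ = b - (c + 1) := by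
    rw [← (Submodule.equivMapOfInjective (LinearMap.mulLeft F Q)
      (fun _ _ hxy => mul_left_cancel₀ hQ0 hxy) (degreeLT F (b - (c + 1)))).finrank_eq,
      finrank_degreeLT]
  have hM₂le : M₂ ≤ orthLT φ a b := by
    rintro _ ⟨B, hB, rfl⟩
    rw [LinearMap.mulLeft_apply]
    refine ⟨mul_mem_degreeLT_of_natDegree (natDegree_le_of_mem_degreeLT hQ.1) hB (by omega),
      fun D hD => ?_⟩
    rcases eq_or_ne B 0 with rfl | hB0
    · simp
    have hB' := (mem_degreeLT_iff_natDegree hB0).1 hB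
    rw [mul_left_comm, mul_comm Q]
    refine hQ.2 _ ?_
    rw [mul_comm]
    exact mul_mem_degreeLT_of_natDegree (a := b - (c + 1) - 1) (by omega) hD (by omega)
  have hinf : M₁ ⊓ M₂ = ⊥ := by
    rw [eq_bot_iff]
    rintro _ ⟨⟨B₁, hB₁, rfl⟩, ⟨B₂, hB₂, heq⟩⟩
    simp only [LinearMap.mulLeft_apply] at heq ⊢
    have := h.eq_zero_of_add_eq_zero hcop hQ0 hdeg (B₁ := B₁) (B₂ := -B₂)
      (degreeLT_mono (by omega) hB₁) (neg_mem (degreeLT_mono (by omega) hB₂))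
      (by rw [← heq]; ring)
    rw [this.1, mul_zero]
    exact zero_mem _
  -- For a < d the transposed kernel vanishes, so the kernel has dimension b - a = (b - d) + (b - c
  -- - 1).
  have hsup : M₁ ⊔ M₂ = orthLT φ a b := by
    refine Submodule.eq_of_le_of_finrank_eq (sup_le (h.map_le hab) hM₂le) ?_
    have h1 := Submodule.finrank_sup_add_finrank_inf_eq M₁ M₂
    have h2 := finrank_orthLT_symm φ a b
    have h3 : orthLT φ b a = ⊥ := by
      rw [eq_bot_iff, ← h.eq_bot]
      exact orthLT_mono (by omega) (by omega)
    rw [h3, finrank_bot] at h2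
    rw [hinf, finrank_bot] at h1
    omega
  intro B
  rw [← hsup, Submodule.mem_sup]
  constructor
  · rintro ⟨_, ⟨B₁, hB₁, rfl⟩, _, ⟨B₂, hB₂, rfl⟩, rfl⟩
    exact ⟨B₁, hB₁, B₂, hB₂, by simp only [LinearMap.mulLeft_apply]; ring⟩
  · rintro ⟨B₁, hB₁, B₂, hB₂, rfl⟩
    exact ⟨_, ⟨B₁, hB₁, rfl⟩, _, ⟨B₂, hB₂, rfl⟩, by simp only [LinearMap.mulLeft_apply]; ring⟩

/-! ### Multiplying the functional by W -/

/-- The effect on the generator of replacing `φ` by `φ (W * ·)`. -/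
theorem IsGen.comp_mulLeft {φ : F[X] →ₗ[F] F} {c d d' s g : ℕ} {P' W' G : F[X]}
    (h : IsGen φ c d (G * P')) (hG : G.Monic) (hg : G.natDegree = g) (hcop : IsCoprime P' W')
    (hW' : W' ≠ 0) (hWs : (G * W').natDegree ≤ s) (hds : d + s ≤ c)
    (hd' : d' = d - g - min (s - (G * W').natDegree) (d - (G * P').natDegree)) :
    IsGen (φ ∘ₗ LinearMap.mulLeft F (G * W')) (c + d - s - d') d' P' := by
  have hP := h.natDegree_le
  have hP'm : P'.Monic := hG.of_mul_monic_left h.monic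
  rw [natDegree_mul hG.ne_zero hW'] at hWs hd'
  rw [natDegree_mul hG.ne_zero hP'm.ne_zero] at hP hd'
  have hWs' : (G * W').natDegree ≤ s := by rwa [natDegree_mul hG.ne_zero hW']
  refine ⟨hP'm, ?_, ?_, by omega⟩
  -- Here d' = max(deg P', d - s + deg W'). These are the two bounds needed for P' and for the
  -- cofactor W' in WP' = PW'.
  · have hmem : P' ∈ degreeLT F (d' + 1) := by
      rw [mem_degreeLT_iff_natDegree hP'm.ne_zero]
      omega
    rw [orthLT_comp_mulLeft hWs' hmem, h.mem_iff (by omega) (by omega)]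
    refine ⟨W', ?_, by ring⟩
    rw [mem_degreeLT_iff_natDegree hW']
    omega
  · rw [eq_bot_iff]
    intro B hB
    have hBd := hB.1
    rw [orthLT_comp_mulLeft hWs' hB.1, h.mem_iff (by omega) (by omega)] at hB
    obtain ⟨C, hC, heq⟩ := hB
    have heq' : W' * B = P' * C := by
      rw [mul_assoc, mul_assoc] at heq
      exact mul_left_cancel₀ hG.ne_zero heq
    obtain ⟨D, rfl⟩ : P' ∣ B := hcop.dvd_of_dvd_mul_left ⟨C, heq'⟩
    have hCD : C = W' * D := by
      refine mul_left_cancel₀ hP'm.ne_zero ?_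
      rw [← heq', mul_left_comm]
    rw [Submodule.mem_bot]
    by_contra hne
    have hD0 : D ≠ 0 := right_ne_zero_of_mul hne
    rw [mem_degreeLT_iff_natDegree hne, natDegree_mul hP'm.ne_zero hD0] at hBd
    rw [hCD, mem_degreeLT_iff_natDegree (mul_ne_zero hW' hD0), natDegree_mul hW' hD0] at hC
    -- A non-zero D would violate whichever of the two bounds attains the maximum d'.
    omega

/-! ### Finite sequences and their characteristic polynomials -/

/-- The linear functional on polynomials with moments `α_0, …, α_n, 0, 0, …`. -/
noncomputable def momentFunctional {n : ℕ} (α : Fin (n + 1) → F) : F[X] →ₗ[F] F :=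
  ∑ i : Fin (n + 1), α i • lcoeff F i

theorem momentFunctional_X_pow {n : ℕ} (α : Fin (n + 1) → F) (i : Fin (n + 1)) :
    momentFunctional α (X ^ (i : ℕ)) = α i := by
  simp [momentFunctional, coeff_X_pow, Fin.val_inj]

/-- The first moments of `φ` are the entries of `α`. -/
def HasMoments (φ : F[X] →ₗ[F] F) {n : ℕ} (α : Fin (n + 1) → F) : Prop :=
  ∀ i : Fin (n + 1), φ (X ^ (i : ℕ)) = α i

namespace HasMoments

variable {φ : F[X] →ₗ[F] F} {n : ℕ} {α : Fin (n + 1) → F}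

theorem hankel_eq (h : HasMoments φ α) {a b : ℕ} (hab : a + b ≤ n + 2) :
    hankel α a b = momentHankel φ a b := by
  ext i j
  simp only [hankel, momentHankel, Matrix.of_apply]
  rw [dif_pos (by omega), ← h]

theorem odot (h : HasMoments φ α) {s : ℕ} (hs : s ≤ n) {W : F[X]} (hW : W.natDegree ≤ s) :
    HasMoments (φ ∘ₗ LinearMap.mulLeft F W) (odot hs α (coeffVec W s)) := by
  intro i
  have hW' : W ∈ degreeLT F (s + 1) := by
    simpa using mul_mem_degreeLT_of_natDegree (b := 1) hW
      ((mem_degreeLT_iff_natDegree one_ne_zero).2 (by simp)) le_rfl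
  rw [LinearMap.comp_apply, LinearMap.mulLeft_apply]
  conv_lhs => rw [eq_sum_fin_of_mem_degreeLT hW', Finset.sum_mul, map_sum]
  rw [HankelSeq.odot]
  refine Finset.sum_congr rfl fun j _ => ?_
  rw [smul_mul_assoc, map_smul, ← pow_add, ← h, smul_eq_mul, mul_comm, coeffVec]
  simp only [add_comm]

theorem isUnit_hankel_iff (h : HasMoments φ α) {k : ℕ} (hk : k ≤ (n + 2) / 2) :
    IsUnit (hankel α k k) ↔ orthLT φ k k = ⊥ := by
  rw [h.hankel_eq (by omega), ← Submodule.finrank_eq_zero (R := F)]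
  have h1 := finrank_orthLT_add_rank φ k k
  constructor
  · intro hu
    rw [Matrix.rank_of_isUnit _ hu, Fintype.card_fin] at h1
    omega
  · intro h0
    rw [← Matrix.mulVec_surjective_iff_isUnit]
    have htop : LinearMap.range (momentHankel φ k k).mulVecLin = ⊤ := by
      refine Submodule.eq_top_of_finrank_eq ?_
      rw [Module.finrank_fin_fun]
      rw [Matrix.rank] at h1
      omega
    exact LinearMap.range_eq_top.1 htop

theorem finrank_add_rk (h : HasMoments φ α) :
    Module.finrank F (orthLT φ ((n + 2) / 2) ((n + 3) / 2)) + rk α = (n + 3) / 2 := by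
  rw [rk, h.hankel_eq (by omega)]
  exact finrank_orthLT_add_rank _ _ _

theorem rk_eq (h : HasMoments φ α) {c d : ℕ} {P : F[X]} (hP : IsGen φ c d P)
    (hn : c + d = n + 1) : rk α = d := by
  have h1 := h.finrank_add_rk
  have h2 := hP.le
  rw [hP.finrank_eq (by omega) (by omega)] at h1
  omega

theorem rho_eq (h : HasMoments φ α) {c d : ℕ} {P : F[X]} (hP : IsGen φ c d P)
    (hn : c + d = n + 1) : rho α = P.natDegree := by
  have h2 := hP.le
  have h3 := hP.natDegree_le
  classical
  rw [rho, Nat.findGreatest_eq_iff]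
  refine ⟨by omega, fun _ => ?_, fun k hk hkn => ?_⟩
  · rw [h.isUnit_hankel_iff (by omega), eq_bot_iff]
    exact fun B hB => hP.eq_zero_of_mem_orthLT hB
  · rw [h.isUnit_hankel_iff hkn]
    intro hbot
    refine hP.monic.ne_zero ((Submodule.eq_bot_iff _).1 hbot P ⟨?_, ?_⟩)
    · rwa [mem_degreeLT_iff_natDegree hP.monic.ne_zero]
    · exact fun D hD => hP.mem.2 D (degreeLT_mono (by omega) hD)

/-- The rank bound gives H_{n₁,n₂} a non-zero kernel. The least d whose matrix with d + 1 columns is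
not injective therefore satisfies d ≤ n₂ - 1, hence d ≤ c, and minimality gives `eq_bot`. -/
theorem exists_isGen (h : HasMoments φ α) (hr : 2 * rk α ≤ n + 1) :
    ∃ c d P, c + d = n + 1 ∧ IsGen φ c d P := by
  classical
  have h1 := h.finrank_add_rk
  have hex : ∃ d, orthLT φ (n + 1 - d) (d + 1) ≠ ⊥ := by
    refine ⟨(n + 3) / 2 - 1, fun hbot => ?_⟩
    rw [show n + 1 - ((n + 3) / 2 - 1) = (n + 2) / 2 by omega,
      show (n + 3) / 2 - 1 + 1 = (n + 3) / 2 by omega] at hbot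
    rw [hbot, finrank_bot] at h1
    omega
  have hle : Nat.find hex ≤ (n + 3) / 2 - 1 := by
    refine Nat.find_min' hex fun hbot => ?_
    rw [show n + 1 - ((n + 3) / 2 - 1) = (n + 2) / 2 by omega,
      show (n + 3) / 2 - 1 + 1 = (n + 3) / 2 by omega] at hbot
    rw [hbot, finrank_bot] at h1
    omega
  have hspec := Nat.find_spec hex
  have hmin : ∀ e < Nat.find hex, orthLT φ (n + 1 - e) (e + 1) = ⊥ := fun e he =>
    not_not.1 (Nat.find_min hex he)
  generalize Nat.find hex = d at *
  obtain ⟨Q, hQ, hQ0⟩ := (Submodule.ne_bot_iff _).1 hspec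
  refine ⟨n + 1 - d, d, Q.leadingCoeff⁻¹ • Q, by omega, ?_, Submodule.smul_mem _ _ hQ, ?_,
    by omega⟩
  · rw [smul_eq_C_mul, mul_comm]
    exact monic_mul_leadingCoeff_inv hQ0
  · rcases Nat.eq_zero_or_pos d with rfl | hd
    · rw [eq_bot_iff]
      intro B hB
      rw [Submodule.mem_bot]
      ext i
      exact mem_degreeLT_iff_coeff.1 hB.1 i (Nat.zero_le i)
    · rw [← hmin (d - 1) (by omega)]
      congr 1 <;> omega

theorem hankel_mulVec_coeffVec (h : HasMoments φ α) {l m : ℕ} (hlm : l + m = n) {B : F[X]}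
    (hB : B ∈ degreeLT F (m + 1)) :
    hankel α (l + 1) (m + 1) *ᵥ coeffVec B m = 0 ↔ B ∈ orthLT φ (l + 1) (m + 1) := by
  rw [mem_orthLT_iff_mulVec hB, h.hankel_eq (by omega)]
  rfl

theorem isFirstCharPoly (h : HasMoments φ α) {c d : ℕ} {P : F[X]} (hP : IsGen φ c d P)
    (hn : c + d = n + 1) : IsFirstCharPoly α P := by
  obtain ⟨Q, hQ, hcop, hker⟩ := hP.exists_pair
  have hle := hP.le
  refine ⟨Q, hcop, hP.monic, (h.rho_eq hP hn).symm, ?_, fun l m hlm => ?_⟩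
  · rw [h.rk_eq hP hn, degLE_iff (k := c + 2) (by omega)]
    exact hQ
  ext v
  simp only [Set.mem_ofPred_eq, h.rk_eq hP hn]
  obtain ⟨⟨B, hB⟩, rfl⟩ := (degreeLTEquiv F (m + 1)).surjective v
  change hankel α (l + 1) (m + 1) *ᵥ coeffVec B m = 0 ↔ ∃ B₁ B₂ : F[X], _ ∧ _ ∧ coeffVec B m = _
  rw [h.hankel_mulVec_coeffVec hlm hB, hker _ _ (by omega) (by omega)]
  constructor
  · rintro ⟨B₁, hB₁, B₂, hB₂, rfl⟩
    exact ⟨B₁, B₂, (degLE_iff (by omega)).2 hB₁, (degLE_iff (by omega)).2 hB₂, rfl⟩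
  · rintro ⟨B₁, B₂, hB₁, hB₂, heq⟩
    have hB₁' := (degLE_iff (k := m + 1 - d) (by omega)).1 hB₁
    have hB₂' := (degLE_iff (k := m + 1 - (c + 1)) (by omega)).1 hB₂
    refine ⟨B₁, hB₁', B₂, hB₂', ?_⟩
    -- Coefficient vectors determine a polynomial only below degree m + 1, so the combination must
    -- first be placed there.
    have hmem := ((hker (l + 1) (m + 1) (by omega) (by omega) _).2
      ⟨B₁, hB₁', B₂, hB₂', rfl⟩).1
    have := (degreeLTEquiv F (m + 1)).injective (a₁ := ⟨B, hB⟩) (a₂ := ⟨_, hmem⟩) heq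
    exact congrArg Subtype.val this

theorem isFirstCharPoly_iff (h : HasMoments φ α) {c d : ℕ} {P : F[X]} (hP : IsGen φ c d P)
    (hn : c + d = n + 1) {A : F[X]} : IsFirstCharPoly α A ↔ A = P := by
  constructor
  · rintro ⟨A₂, -, hA, hdeg, -, hker⟩
    have hle := hP.le
    have hPd := hP.natDegree_le
    rw [h.rho_eq hP hn] at hdeg
    have hAd : A ∈ degreeLT F (d + 1) := by
      rw [mem_degreeLT_iff_natDegree hA.ne_zero]
      omega
    have hmem : coeffVec A d ∈
        {v : Fin (d + 1) → F | hankel α (n - d + 1) (d + 1) *ᵥ v = 0} := by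
      rw [hker (n - d) d (by omega)]
      -- At m = r the bound deg B₁ ≤ 0 admits B₁ = 1, so A itself lies in the kernel and is a
      -- multiple of P of the same degree.
      refine ⟨1, 0, ?_, ?_, by simp⟩
      · rw [h.rk_eq hP hn, degLE_iff (k := 1) (by omega), mem_degreeLT_iff_natDegree one_ne_zero]
        simp
      · intro i _
        simp
    rw [Set.mem_ofPred_eq, h.hankel_mulVec_coeffVec (by omega) hAd,
      hP.mem_iff (by omega) (by omega)] at hmem
    obtain ⟨C, -, hC⟩ := hmem
    exact (eq_of_monic_of_dvd_of_natDegree_le hP.monic hA ⟨C, hC⟩ hdeg.le)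
  · rintro rfl
    exact h.isFirstCharPoly hP hn

end HasMoments

/-! ### The two parts of the lemma -/

theorem odot_charPoly {n s : ℕ} (hs : s ≤ n) {W : F[X]} {α : Fin (n + 1) → F} (hW0 : W ≠ 0)
    (hWs : W.natDegree ≤ s) (hr : 2 * rk α + s ≤ n + 1) :
    (∃! A₁ : F[X], IsFirstCharPoly α A₁) ∧ ∀ A₁ : F[X], IsFirstCharPoly α A₁ →
      (rk (odot hs α (coeffVec W s)) : ℤ) =
        rk α - (monicGcd A₁ W).natDegree - min ((s : ℤ) - W.natDegree) (piChar α) ∧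
      (rho (odot hs α (coeffVec W s)) : ℤ) = rho α - (monicGcd A₁ W).natDegree ∧
      piChar (odot hs α (coeffVec W s)) = max 0 (piChar α - ((s : ℤ) - W.natDegree)) ∧
      (∀ A' : F[X], IsFirstCharPoly (odot hs α (coeffVec W s)) A' ↔
        A' = A₁ / monicGcd A₁ W) := by
  have hφ : HasMoments (momentFunctional α) α := momentFunctional_X_pow α
  obtain ⟨c, d, P, hn, hP⟩ := hφ.exists_isGen (by omega)
  have hiff := fun A => hφ.isFirstCharPoly_iff (A := A) hP hn
  refine ⟨⟨P, (hiff P).2 rfl, fun A hA => (hiff A).1 hA⟩, fun A₁ hA₁ => ?_⟩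
  obtain rfl := (hiff A₁).1 hA₁
  have hrk := hφ.rk_eq hP hn
  have hrho := hφ.rho_eq hP hn
  obtain ⟨P', W', hcop, hP', hW'⟩ := exists_coprime_mul_monicGcd (A := A₁) hW0
  have hG : (monicGcd A₁ W).Monic := monicGcd_monic hW0
  set G := monicGcd A₁ W
  have hW'0 : W' ≠ 0 := fun h0 => hW0 (by rw [hW', h0, mul_zero])
  have hdegP : A₁.natDegree = G.natDegree + P'.natDegree := by
    rw [hP', natDegree_mul hG.ne_zero (right_ne_zero_of_mul (hP' ▸ hP.monic.ne_zero))]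
  have hdegA := hP.natDegree_le
  have hgen := (hP' ▸ hP : IsGen _ c d (G * P')).comp_mulLeft hG rfl hcop hW'0 (s := s)
    (by rwa [← hW']) (by omega) rfl
  rw [← hW', ← hP'] at hgen
  have hφ' := hφ.odot hs hWs
  have hn' : c + d - s - (d - G.natDegree - min (s - W.natDegree) (d - A₁.natDegree)) +
      (d - G.natDegree - min (s - W.natDegree) (d - A₁.natDegree)) = n - s + 1 := by omega
  have hrk' := hφ'.rk_eq hgen hn'
  have hrho' := hφ'.rho_eq hgen hn'
  have hdiv : A₁ / G = P' := by
    conv_lhs => rw [hP']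
    exact mul_div_cancel_left₀ P' hG.ne_zero
  refine ⟨?_, ?_, ?_, fun A' => ?_⟩
  · rw [piChar]; omega
  · omega
  · rw [piChar, piChar]; omega
  · rw [hφ'.isFirstCharPoly_iff hgen hn', hdiv]

theorem rk_strictRho_odot {n s : ℕ} (hs : s ≤ n) {W : F[X]} {α : Fin (n + 1) → F} (hW0 : W ≠ 0)
    (hWs : W.natDegree = s) (hs1 : 1 ≤ s) (heven : Even (n - s))
    (hr : rk α = (n - s) / 2 + 1) (hrho : strictRho α = 0) :
    rk (odot hs α (coeffVec W s)) = (n - s) / 2 + 1 ∧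
      strictRho (odot hs α (coeffVec W s)) = 0 := by
  have hφ : HasMoments (momentFunctional α) α := momentFunctional_X_pow α
  obtain ⟨t, ht⟩ := heven
  obtain ⟨c, d, P, hn, hP⟩ := hφ.exists_isGen (by omega)
  have hd := hφ.rk_eq hP hn
  have hle := hP.le
  have hPd := hP.natDegree_le
  have hP1 : P = 1 := by
    refine eq_one_of_monic_natDegree_zero hP.monic ?_
    by_contra hne
    classical
    rw [strictRho, Nat.findGreatest_eq_zero_iff] at hrho
    -- The Hankel matrix of size deg P is invertible, and s ≥ 1 keeps deg P ≤ r within the strict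
    -- range n₂ - 1.
    refine hrho (Nat.pos_of_ne_zero hne) (by omega) ?_
    rw [hφ.isUnit_hankel_iff (by omega), eq_bot_iff]
    exact fun B hB => hP.eq_zero_of_mem_orthLT hB
  subst hP1
  have hφ' := hφ.odot hs hWs.le
  constructor
  · have h1 := hφ'.finrank_add_rk
    have hbot : orthLT (momentFunctional α ∘ₗ LinearMap.mulLeft F W)
        ((n - s + 2) / 2) ((n - s + 3) / 2) = ⊥ := by
      rw [eq_bot_iff]
      intro B hB
      rw [orthLT_comp_mulLeft hWs.le hB.1, hP.mem_iff (by omega) (by omega)] at hB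
      obtain ⟨C, hC, heq⟩ := hB
      rw [one_mul] at heq
      rw [← heq] at hC
      -- Here deg WB < s = deg W, so B = 0 and the central matrix has full rank.
      have h2 := mem_degreeLT_of_mul hW0 hC
      rw [Submodule.mem_bot]
      ext i
      exact mem_degreeLT_iff_coeff.1 h2 i (by omega)
    rw [hbot, finrank_bot] at h1
    omega
  · classical
    rw [strictRho, Nat.findGreatest_eq_zero_iff]
    intro k hk hkn
    rw [hφ'.isUnit_hankel_iff (by omega)]
    intro hbot
    refine one_ne_zero (α := F[X]) ((Submodule.eq_bot_iff _).1 hbot 1 ?_)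
    have h1 : (1 : F[X]) ∈ degreeLT F 1 := by
      rw [mem_degreeLT_iff_natDegree one_ne_zero]; simp
    -- The constant 1 lies in every kernel in range: deg D < (n - s)/2 gives deg DW < (n - s)/2 + s
    -- = c, where φ vanishes.
    refine orthLT_mono (a := (n - s) / 2) (b := 1) (by omega) hk ?_
    rw [orthLT_comp_mulLeft hWs.le h1]
    refine ⟨by rw [mem_degreeLT_iff_natDegree (by simpa)]; simp; omega, fun D hD => ?_⟩
    have := hP.mem.2 (D * W) ?_
    · rwa [mul_one] at this ⊢
    · rw [mul_comm]
      exact mul_mem_degreeLT_of_natDegree hWs.le hD (by omega)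

/-- For s = 0, part (2) has 2r = n + 2, outside the range of `exists_isGen`; scaling handles this
case. -/
theorem hankel_odot_C {n : ℕ} (hs : 0 ≤ n) (α : Fin (n + 1) → F) (w : F) (a b : ℕ) :
    hankel (odot hs α (coeffVec (C w) 0)) a b = w • hankel α a b := by
  ext i j
  simp only [hankel, odot, coeffVec, Matrix.of_apply, Matrix.smul_apply, smul_eq_mul, mul_dite,
    mul_zero, Nat.sub_zero]
  split_ifs
  · simp [mul_comm]
  · rfl

theorem rk_strictRho_odot_C {n : ℕ} (hs : 0 ≤ n) (α : Fin (n + 1) → F) {w : F} (hw : w ≠ 0) :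
    rk (odot hs α (coeffVec (C w) 0)) = rk α ∧
      strictRho (odot hs α (coeffVec (C w) 0)) = strictRho α := by
  constructor
  · rw [rk, hankel_odot_C]
    exact Matrix.rank_smul_of_mem_nonZeroDivisors _ (mem_nonZeroDivisors_of_ne_zero hw)
  · classical
    refine (Nat.findGreatest_eq_iff (P := fun k => IsUnit (hankel _ k k))).2 ?_
    have h := (Nat.findGreatest_eq_iff (P := fun k => IsUnit (hankel α k k))).1
      (rfl : _ = strictRho α)
    have hu : ∀ k, IsUnit (w • hankel α k k) ↔ IsUnit (hankel α k k) :=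
      fun k => isUnit_smul_iff (Units.mk0 w hw) (hankel α k k)
    simpa only [hankel_odot_C, hu, Nat.sub_zero] using h

end HankelSeq

theorem mainTheorem3 {F : Type*} [Field F] [Finite F] (hq : Odd (Nat.card F)) :
    (∀ (n s : ℕ) (hs : s ≤ n) (W : Polynomial F) (s₁ r₁ ρ₁ π₁ : ℕ) (α : Fin (n + 1) → F),
      W ≠ 0 → W.natDegree = s₁ → s₁ ≤ s →
      2 ≤ n → 2 * (r₁ : ℤ) + s - 1 ≤ n →
      α ∈ HankelSeq.seqSet F n r₁ ρ₁ π₁ →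
      (∃! A₁ : Polynomial F, HankelSeq.IsFirstCharPoly α A₁) ∧
      ∀ A₁ : Polynomial F, HankelSeq.IsFirstCharPoly α A₁ →
        (HankelSeq.rk (HankelSeq.odot hs α (HankelSeq.coeffVec W s)) : ℤ) =
          r₁ - (HankelSeq.monicGcd A₁ W).natDegree - min ((s : ℤ) - s₁) π₁ ∧
        (HankelSeq.rho (HankelSeq.odot hs α (HankelSeq.coeffVec W s)) : ℤ) =
          ρ₁ - (HankelSeq.monicGcd A₁ W).natDegree ∧
        HankelSeq.piChar (HankelSeq.odot hs α (HankelSeq.coeffVec W s)) =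
          max 0 ((π₁ : ℤ) - ((s : ℤ) - s₁)) ∧
        (∀ A' : Polynomial F,
          HankelSeq.IsFirstCharPoly (HankelSeq.odot hs α (HankelSeq.coeffVec W s)) A' ↔
            A' = A₁ / HankelSeq.monicGcd A₁ W)) ∧
    (∀ (n s : ℕ) (hs : s ≤ n) (W : Polynomial F) (α : Fin (n + 1) → F),
      W ≠ 0 → W.natDegree = s → 2 ≤ n - s → Even (n - s) →
      α ∈ HankelSeq.strictSeqSet F n ((n - s) / 2 + 1) 0 ((n - s) / 2 + 1) →
      HankelSeq.odot hs α (HankelSeq.coeffVec W s) ∈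
        HankelSeq.strictSeqSet F (n - s) ((n - s) / 2 + 1) 0 ((n - s) / 2 + 1)) := by
  constructor
  · rintro n s hs W s₁ r₁ ρ₁ π₁ α hW0 rfl hs₁ - hn ⟨rfl, rfl, hπ⟩
    rw [← hπ]
    exact HankelSeq.odot_charPoly hs hW0 hs₁ (by omega)
  · rintro n s hs W α hW0 hWs - heven ⟨hr, hρ, -⟩
    have key : HankelSeq.rk (HankelSeq.odot hs α (HankelSeq.coeffVec W s)) = (n - s) / 2 + 1 ∧
        HankelSeq.strictRho (HankelSeq.odot hs α (HankelSeq.coeffVec W s)) = 0 := by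
      rcases Nat.eq_zero_or_pos s with rfl | hs1
      · obtain ⟨w, rfl⟩ := Polynomial.natDegree_eq_zero.1 hWs
        have hw : w ≠ 0 := by simpa using hW0
        obtain ⟨h1, h2⟩ := HankelSeq.rk_strictRho_odot_C hs α hw
        exact ⟨h1.trans hr, h2.trans hρ⟩
      · exact HankelSeq.rk_strictRho_odot hs hW0 hWs hs1 heven hr hρ
    refine ⟨key.1, key.2, ?_⟩
    rw [HankelSeq.strictPi, key.1, key.2]
    simp
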